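/- Let $n\ge 1$, let $h:[0,\infty)\to\mathbb R$ be a function, and let $W:\mathbb R^{n\times n}\to\mathbb R$ be the Valanis--Landel function $$W(F)=\sum_{k=1}^n h(\lambda_k(F)),$$ where $\lambda_1(F),\dots,\lambda_n(F)\ge 0$ are the singular values of $F$, i.e. the eigenvalues of $\sqrt{F^TF}$ counted with multiplicity. (No continuity or boundedness of $h$ is assumed.) Then each of the following four statements is equivalent to: $h$ is convex and monotone increasing (that is, non-decreasing) on $[0,\infty)$. 1. $W$ is rank-one convex: $W((1-t)F_1+tF_2)\le(1-t)W(F_1)+tW(F_2)$ for all $t\in[0,1]$ and all $F_1,F_2\in\mathbb R^{n\times n}$ with $\operatorname{rank}(F_2-F_1)=1$. 2. $W$ is quasiconvex: $\int_\Omega W(F+\nabla\vartheta(x))\,dx\ge|\Omega|\,W(F)$ for every bounded open set $\Omega\subset\mathbb R^n$ with $|\partial\Omega|=0$, every $F\in\mathbb R^{n\times n}$ and every $\vartheta\in W^{1,\infty}_0(\Omega;\mathbb R^n)=W^{1,\infty}(\Omega;\mathbb R^n)\cap W^{1,1}_0(\Omega;\mathbb R^n)$ for which the integral exists (as a Lebesgue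 integral with values in $[-\infty,\infty]$). 3. $W$ is polyconvex: $W(F)$ is a convex real-valued function, defined on the whole Euclidean space of the appropriate dimension, of the vector of all minors of $F$ of orders $1,\dots,n$. 4. $W$ is convex on $\mathbb R^{n\times n}$. -/

import Mathlib

open MeasureTheory Set Filter Topology
open scoped ContDiff ENNReal

noncomputable section

namespace GenConvexity

variable {n : ℕ}

/-- The partial derivative `∂ⱼ φ (x)` of a scalar function on `ℝⁿ`. -/
def partialDeriv (j : Fin n) (φ : EuclideanSpace ℝ (Fin n) → ℝ)
    (x : EuclideanSpace ℝ (Fin n)) : ℝ :=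
  fderiv ℝ φ x (EuclideanSpace.single j 1)

/-- Scalar test functions: `φ ∈ C_c^∞(Ω)`. -/
structure IsTestFunction (Ω : Set (EuclideanSpace ℝ (Fin n)))
    (φ : EuclideanSpace ℝ (Fin n) → ℝ) : Prop where
  smooth : ContDiff ℝ ∞ φ
  hasCompactSupport : HasCompactSupport φ
  tsupport_subset : tsupport φ ⊆ Ω

/-- `θ ∈ W^{1,∞}(Ω; ℝⁿ)` with weak gradient `G`, where `G x i j` is `∂ⱼ θᵢ (x)`: all components of
`θ` and `G` are in `L^∞(Ω)` and `∫_Ω θᵢ ∂ⱼφ = - ∫_Ω Gᵢⱼ φ` for all `φ ∈ C_c^∞(Ω)`. -/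
structure MemSobolevInfty (Ω : Set (EuclideanSpace ℝ (Fin n)))
    (θ : EuclideanSpace ℝ (Fin n) → EuclideanSpace ℝ (Fin n))
    (G : EuclideanSpace ℝ (Fin n) → Matrix (Fin n) (Fin n) ℝ) : Prop where
  memLp : ∀ i, MemLp (fun x => θ x i) ⊤ (volume.restrict Ω)
  memLp_grad : ∀ i j, MemLp (fun x => G x i j) ⊤ (volume.restrict Ω)
  weak_grad : ∀ φ, IsTestFunction Ω φ → ∀ i j,
    ∫ x in Ω, θ x i * partialDeriv j φ x = - ∫ x in Ω, G x i j * φ x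

/-- `θ`, with gradient `G`, lies in `W_0^{1,1}(Ω; ℝⁿ)`, the closure of `C_c^∞(Ω; ℝⁿ)` with respect
to the norm of `W^{1,1}(Ω; ℝⁿ)`. -/
def MemSobolevZeroOne (Ω : Set (EuclideanSpace ℝ (Fin n)))
    (θ : EuclideanSpace ℝ (Fin n) → EuclideanSpace ℝ (Fin n))
    (G : EuclideanSpace ℝ (Fin n) → Matrix (Fin n) (Fin n) ℝ) : Prop :=
  ∃ φ : ℕ → Fin n → EuclideanSpace ℝ (Fin n) → ℝ,
    (∀ k i, IsTestFunction Ω (φ k i)) ∧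
    (∀ i, Tendsto (fun k => eLpNorm (fun x => φ k i x - θ x i) 1 (volume.restrict Ω))
      atTop (𝓝 0)) ∧
    (∀ i j, Tendsto
      (fun k => eLpNorm (fun x => partialDeriv j (φ k i) x - G x i j) 1 (volume.restrict Ω))
      atTop (𝓝 0))

/-- `θ ∈ W_0^{1,∞}(Ω; ℝⁿ)` with weak gradient `G`, for bounded open `Ω`, where
`W_0^{1,∞}(Ω; ℝⁿ) = W^{1,∞}(Ω; ℝⁿ) ∩ W_0^{1,1}(Ω; ℝⁿ)`. -/
def MemSobolevZeroInfty (Ω : Set (EuclideanSpace ℝ (Fin n)))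
    (θ : EuclideanSpace ℝ (Fin n) → EuclideanSpace ℝ (Fin n))
    (G : EuclideanSpace ℝ (Fin n) → Matrix (Fin n) (Fin n) ℝ) : Prop :=
  MemSobolevInfty Ω θ G ∧ MemSobolevZeroOne Ω θ G

/-- The Lebesgue integral of `f` exists (possibly with value `±∞`): `f` is measurable and its
positive or its negative part has finite integral. -/
def IntegralExists {α : Type*} [MeasurableSpace α] (f : α → ℝ) (μ : Measure α) : Prop :=
  AEMeasurable f μ ∧
    (∫⁻ x, ENNReal.ofReal (f x) ∂μ ≠ ⊤ ∨ ∫⁻ x, ENNReal.ofReal (-f x) ∂μ ≠ ⊤)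

/-- The extended-real value of the Lebesgue integral, `∫ f⁺ - ∫ f⁻`, when it exists. -/
def extIntegral {α : Type*} [MeasurableSpace α] (f : α → ℝ) (μ : Measure α) : EReal :=
  ((∫⁻ x, ENNReal.ofReal (f x) ∂μ : ℝ≥0∞) : EReal) -
    ((∫⁻ x, ENNReal.ofReal (-f x) ∂μ : ℝ≥0∞) : EReal)

/-- `W : ℝ^{n×n} → ℝ` is rank-one convex. -/
def RankOneConvex (W : Matrix (Fin n) (Fin n) ℝ → ℝ) : Prop :=
  ∀ F₁ F₂ : Matrix (Fin n) (Fin n) ℝ, (F₂ - F₁).rank = 1 →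
    ∀ t ∈ Icc (0 : ℝ) 1, W ((1 - t) • F₁ + t • F₂) ≤ (1 - t) * W F₁ + t * W F₂

/-- `W : ℝ^{n×n} → ℝ` is quasiconvex: `∫_Ω W (F + ∇θ) dx ≥ |Ω| W(F)` for every bounded open `Ω` with
`|∂Ω| = 0`, every `F` and every `θ ∈ W_0^{1,∞}(Ω; ℝⁿ)` for which the integral exists. -/
def Quasiconvex (W : Matrix (Fin n) (Fin n) ℝ → ℝ) : Prop :=
  ∀ Ω : Set (EuclideanSpace ℝ (Fin n)), IsOpen Ω → Bornology.IsBounded Ω →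
    volume (frontier Ω) = 0 →
    ∀ (F : Matrix (Fin n) (Fin n) ℝ)
      (θ : EuclideanSpace ℝ (Fin n) → EuclideanSpace ℝ (Fin n))
      (G : EuclideanSpace ℝ (Fin n) → Matrix (Fin n) (Fin n) ℝ),
      MemSobolevZeroInfty Ω θ G →
      IntegralExists (fun x => W (F + G x)) (volume.restrict Ω) →
      (((volume Ω).toReal * W F : ℝ) : EReal) ≤
        extIntegral (fun x => W (F + G x)) (volume.restrict Ω)

/-- Labels of the minors of an `n × n` matrix: an order `k + 1` with `0 ≤ k < n`, and increasing
choices of `k + 1` rows and of `k + 1` columns. -/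
abbrev MinorIndex (n : ℕ) : Type :=
  Σ k : Fin n, (Fin (k + 1) ↪o Fin n) × (Fin (k + 1) ↪o Fin n)

/-- The vector of all minors of `F`, of all orders `1, …, n`. -/
def minors (F : Matrix (Fin n) (Fin n) ℝ) : MinorIndex n → ℝ :=
  fun s => (F.submatrix s.2.1 s.2.2).det

/-- `W : ℝ^{n×n} → ℝ` is polyconvex: it is a convex function of the vector of all minors. -/
def Polyconvex (W : Matrix (Fin n) (Fin n) ℝ → ℝ) : Prop :=
  ∃ g : (MinorIndex n → ℝ) → ℝ, ConvexOn ℝ univ g ∧ ∀ F, W F = g (minors F)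

/-- The singular values `λ₁ ≥ … ≥ λₙ ≥ 0` of `F`, with multiplicity. -/
def singularValue (F : Matrix (Fin n) (Fin n) ℝ) (k : Fin n) : ℝ :=
  (Matrix.toEuclideanLin F).singularValues k

end GenConvexity

end

noncomputable section

namespace GenConvexity

variable {n : ℕ}

open scoped Convolution

/-! The hub is convexity of `W`: it follows from the condition on `h` and implies the other three
notions, while each notion gives back the condition on `h` from the single line `t ↦ t E_ii`.

From `h` to `W`: in singular bases of `s A + t B`, the singular values are diagonal entries, hence
linear in `A` and `B`. It remains to bound the sum of `h` over the absolute diagonal entries of a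
matrix, in any two orthonormal bases, by the sum over its singular values. The absolute entries are
dominated by a doubly stochastic average of the singular values, so monotonicity and Jensen suffice
(`sum_abs_inner_le_sum_singularValue`). Convexity then gives quasiconvexity by Jensen, since
admissible gradients have mean zero, and polyconvexity because the entries are the minors of order
one.

Back to `h`: on the line, `W` equals `h |t| + (n - 1) h 0`, and convexity of `t ↦ h |t|` on the
whole real line is the condition on `h`. Rank-one convexity and polyconvexity restrict directly to
the line. For quasiconvexity the test functions are thin roofs over a box: apart from a small
fraction of the box, their gradient takes two values `α` and `-β` in direction `i`. They are
Lipschitz with finitely many gradient values, so no regularity of `h` is needed. -/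

/-! ### Singular values and convexity of `W`. -/

/-- Singular value decomposition of a square matrix. -/
theorem exists_svd (F : Matrix (Fin n) (Fin n) ℝ) :
    ∃ a b : OrthonormalBasis (Fin n) ℝ (EuclideanSpace ℝ (Fin n)),
      ∀ k, Matrix.toEuclideanLin F (b k) = singularValue F k • a k := by
  set T := Matrix.toEuclideanLin F with hT
  have hn : Module.finrank ℝ (EuclideanSpace ℝ (Fin n)) = n := by simp
  have hsym := T.isSymmetric_adjoint_comp_self
  let b := hsym.eigenvectorBasis hn
  have hinner : ∀ i j, inner ℝ (T (b i)) (T (b j)) =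
      if i = j then singularValue F i ^ 2 else 0 := by
    intro i j
    have h1 : inner ℝ (T (b i)) (T (b j)) = inner ℝ ((T.adjoint ∘ₗ T) (b i)) (b j) := by
      rw [LinearMap.comp_apply, LinearMap.adjoint_inner_left]
    rw [h1, hsym.apply_eigenvectorBasis hn i]
    rw [inner_smul_left, orthonormal_iff_ite.mp b.orthonormal]
    have := T.sq_singularValues_fin hn i
    simp only [singularValue, ← hT, this]
    simp
  -- Left singular vectors are forced only where the singular value is nonzero; an arbitrary
  -- orthonormal completion serves the kernel.
  have hv : Orthonormal ℝ (({k | singularValue F k ≠ 0} : Set (Fin n)).domRestrict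
      fun k => (singularValue F k)⁻¹ • T (b k)) := by
    rw [orthonormal_iff_ite]
    rintro ⟨i, hi⟩ ⟨j, hj⟩
    simp only [Set.domRestrict_apply, inner_smul_left, inner_smul_right, hinner, Subtype.mk.injEq]
    split_ifs with hij
    · subst hij
      have : singularValue F i ≠ 0 := hi
      simp only [conj_trivial]
      field_simp
    · simp
  obtain ⟨a, ha⟩ := hv.exists_orthonormalBasis_extension_of_card_eq (by simp)
  refine ⟨a, b, fun k => ?_⟩
  by_cases hk : singularValue F k = 0
  · rw [hk, zero_smul, ← norm_eq_zero, ← sq_eq_zero_iff, ← real_inner_self_eq_norm_sq, hinner]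
    simp [hk]
  · rw [ha k hk, smul_smul, mul_inv_cancel₀ hk, one_smul]

theorem singularValue_nonneg (F : Matrix (Fin n) (Fin n) ℝ) (k : Fin n) :
    0 ≤ singularValue F k :=
  LinearMap.singularValues_nonneg _ _

/-- The sum of `h` over the diagonal entries of `F` in a pair of orthonormal bases is at most
the sum of `h` over the singular values. -/
theorem sum_abs_inner_le_sum_singularValue {h : ℝ → ℝ} (hc : ConvexOn ℝ (Ici 0) h)
    (hm : MonotoneOn h (Ici 0)) (F : Matrix (Fin n) (Fin n) ℝ)
    (u v : OrthonormalBasis (Fin n) ℝ (EuclideanSpace ℝ (Fin n))) :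
    ∑ k, h |inner ℝ (u k) (Matrix.toEuclideanLin F (v k))| ≤ ∑ k, h (singularValue F k) := by
  obtain ⟨a, b, hab⟩ := exists_svd F
  -- From `|p q| ≤ (p² + q²) / 2` applied to the coefficients in `hexp`. Parseval makes `P` doubly
  -- stochastic: row sums serve Jensen, column sums the final summation over `k`.
  let P : Fin n → Fin n → ℝ := fun k j => (inner ℝ (u k) (a j) ^ 2 + inner ℝ (b j) (v k) ^ 2) / 2
  have hP : ∀ k j, 0 ≤ P k j := fun k j => by positivity
  have hrow : ∀ k, ∑ j, P k j = 1 := by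
    intro k
    rw [← Finset.sum_div, Finset.sum_add_distrib]
    have h1 := a.sum_sq_inner_right (u k)
    have h2 := b.sum_sq_inner_right (v k)
    simp only [real_inner_comm (u k)] at h1 ⊢
    simp [h1, h2, u.orthonormal.1 k, v.orthonormal.1 k]
  have hcol : ∀ j, ∑ k, P k j = 1 := by
    intro j
    rw [← Finset.sum_div, Finset.sum_add_distrib]
    have h1 := u.sum_sq_inner_right (a j)
    have h2 := v.sum_sq_inner_left (b j)
    simp [h1, h2, a.orthonormal.1 j, b.orthonormal.1 j]
  have hexp : ∀ k, inner ℝ (u k) (Matrix.toEuclideanLin F (v k)) =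
      ∑ j, singularValue F j * (inner ℝ (u k) (a j) * inner ℝ (b j) (v k)) := by
    intro k
    conv_lhs => rw [← b.sum_repr' (v k)]
    simp only [map_sum, map_smul, hab, inner_sum, inner_smul_right]
    exact Finset.sum_congr rfl fun j _ => by ring
  have hbound : ∀ k, h |inner ℝ (u k) (Matrix.toEuclideanLin F (v k))| ≤
      ∑ j, P k j * h (singularValue F j) := by
    intro k
    have h1 : |inner ℝ (u k) (Matrix.toEuclideanLin F (v k))| ≤ ∑ j, P k j * singularValue F j := by
      rw [hexp]
      refine (Finset.abs_sum_le_sum_abs _ _).trans (Finset.sum_le_sum fun j _ => ?_)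
      rw [abs_mul, abs_of_nonneg (singularValue_nonneg F j), mul_comm]
      refine mul_le_mul_of_nonneg_right ?_ (singularValue_nonneg F j)
      rw [abs_le]
      constructor <;> simp only [P]
      · nlinarith [sq_nonneg (inner ℝ (u k) (a j) + inner ℝ (b j) (v k))]
      · nlinarith [sq_nonneg (inner ℝ (u k) (a j) - inner ℝ (b j) (v k))]
    refine (hm (mem_Ici.2 (abs_nonneg _)) (mem_Ici.2 ((abs_nonneg _).trans h1)) h1).trans ?_
    have := hc.map_sum_le (t := Finset.univ) (w := P k) (p := singularValue F)
      (fun j _ => hP k j) (hrow k) (fun j _ => singularValue_nonneg F j)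
    simpa using this
  calc _ ≤ ∑ k, ∑ j, P k j * h (singularValue F j) := Finset.sum_le_sum fun k _ => hbound k
    _ = ∑ j, (∑ k, P k j) * h (singularValue F j) := by
        rw [Finset.sum_comm]; simp only [Finset.sum_mul]
    _ = _ := by simp [hcol]

/-- With the singular bases of `s A + t B` fixed, its singular values split linearly into diagonal
entries of `A` and of `B`, to which the preceding bound applies separately. -/
theorem convexOn_sum_singularValue {h : ℝ → ℝ} (hc : ConvexOn ℝ (Ici 0) h)
    (hm : MonotoneOn h (Ici 0)) :
    ConvexOn ℝ univ fun F : Matrix (Fin n) (Fin n) ℝ => ∑ k, h (singularValue F k) := by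
  refine ⟨convex_univ, fun A _ B _ s t hs ht hst => ?_⟩
  obtain ⟨a, b, hab⟩ := exists_svd (s • A + t • B)
  have key : ∀ k, h (singularValue (s • A + t • B) k) ≤
      s * h |inner ℝ (a k) (Matrix.toEuclideanLin A (b k))| +
        t * h |inner ℝ (a k) (Matrix.toEuclideanLin B (b k))| := by
    intro k
    have h1 : singularValue (s • A + t • B) k =
        s * inner ℝ (a k) (Matrix.toEuclideanLin A (b k)) +
          t * inner ℝ (a k) (Matrix.toEuclideanLin B (b k)) := by
      have h2 : inner ℝ (a k) (Matrix.toEuclideanLin (s • A + t • B) (b k)) =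
          singularValue (s • A + t • B) k := by
        rw [hab, inner_smul_right, real_inner_self_eq_norm_sq, a.orthonormal.1 k]; simp
      rw [← h2]
      simp [inner_add_right, inner_smul_right]
    have h3 : singularValue (s • A + t • B) k ≤
        s * |inner ℝ (a k) (Matrix.toEuclideanLin A (b k))| +
          t * |inner ℝ (a k) (Matrix.toEuclideanLin B (b k))| := by
      rw [h1]
      exact add_le_add (mul_le_mul_of_nonneg_left (le_abs_self _) hs)
        (mul_le_mul_of_nonneg_left (le_abs_self _) ht)
    exact (hm (singularValue_nonneg _ k) ((singularValue_nonneg _ k).trans h3) h3).trans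
      (hc.2 (mem_Ici.2 (abs_nonneg _)) (mem_Ici.2 (abs_nonneg _)) hs ht hst)
  calc _ ≤ ∑ k, (s * h |inner ℝ (a k) (Matrix.toEuclideanLin A (b k))| +
        t * h |inner ℝ (a k) (Matrix.toEuclideanLin B (b k))|) :=
      Finset.sum_le_sum fun k _ => key k
    _ ≤ _ := by
      rw [Finset.sum_add_distrib, ← Finset.mul_sum, ← Finset.mul_sum]
      exact add_le_add
        (mul_le_mul_of_nonneg_left (sum_abs_inner_le_sum_singularValue hc hm A a b) hs)
        (mul_le_mul_of_nonneg_left (sum_abs_inner_le_sum_singularValue hc hm B a b) ht)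

/-! ### The diagonal line and the function `t ↦ h |t|`. -/

/-- The images of the right singular vectors are all multiples of one basis vector, yet mutually
orthogonal, so at most one singular value is nonzero; the squares sum to `t²`, so it is `|t|`. Its
position need not be known. -/
theorem sum_singularValue_smul_single (h : ℝ → ℝ) (i : Fin n) (t : ℝ) :
    ∑ k, h (singularValue (t • Matrix.single i i (1 : ℝ)) k) = h |t| + (n - 1) * h 0 := by
  set E : Matrix (Fin n) (Fin n) ℝ := Matrix.single i i 1
  set σ := singularValue (t • E)
  obtain ⟨a, b, hab⟩ := exists_svd (t • E)
  have hE : ∀ x : EuclideanSpace ℝ (Fin n), Matrix.toEuclideanLin (t • E) x =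
      (t * x i) • EuclideanSpace.single i 1 := by
    intro x
    ext j
    have h1 : (Matrix.toEuclideanLin (t • E) x) j = ∑ k, (t • E) j k * x k := rfl
    rw [h1, Finset.sum_eq_single i]
    · by_cases hj : j = i
      · simp [E, hj]
      · simp [E, hj, Ne.symm hj]
    · intro k _ hk
      simp [E, hk.symm]
    · simp
  have hab' : ∀ k, (t * b k i) • EuclideanSpace.single i (1 : ℝ) = σ k • a k :=
    fun k => by rw [← hE, hab]
  have habs : ∀ k, σ k = |t * b k i| := by
    intro k
    have := congrArg norm (hab' k)
    rw [norm_smul, norm_smul, a.orthonormal.1 k, Real.norm_eq_abs, Real.norm_eq_abs,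
      abs_of_nonneg (singularValue_nonneg _ k)] at this
    simpa using this.symm
  have hsq : ∑ k, σ k ^ 2 = t ^ 2 := by
    have := b.sum_sq_inner_right (EuclideanSpace.single i (1 : ℝ))
    simp only [EuclideanSpace.inner_single_right, one_mul, PiLp.norm_single, norm_one, one_pow,
      conj_trivial] at this
    simp only [habs, sq_abs, mul_pow, ← Finset.mul_sum, this, mul_one]
  have hne : ∀ k l, k ≠ l → σ k = 0 ∨ σ l = 0 := by
    intro k l hkl
    have h1 : inner ℝ (σ k • a k) (σ l • a l) = 0 := by
      rw [inner_smul_left, inner_smul_right, orthonormal_iff_ite.mp a.orthonormal]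
      simp [hkl]
    rw [← hab', ← hab', inner_smul_left, inner_smul_right] at h1
    simp at h1
    rw [habs, habs]
    simp only [abs_eq_zero, mul_eq_zero]
    tauto
  obtain ⟨k, hk⟩ : ∃ k, ∀ l, l ≠ k → σ l = 0 := by
    by_cases h0 : ∃ k, σ k ≠ 0
    · obtain ⟨k, hk⟩ := h0
      exact ⟨k, fun l hl => (hne l k hl).resolve_right hk⟩
    · push Not at h0
      exact ⟨i, fun l _ => h0 l⟩
  have hkt : σ k = |t| := by
    rw [Finset.sum_eq_single k (fun l _ hl => by rw [hk l hl]; simp) (by simp)] at hsq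
    rw [← abs_of_nonneg (show 0 ≤ σ k from singularValue_nonneg _ k)]
    exact (sq_eq_sq_iff_abs_eq_abs _ _).mp hsq
  rw [← Finset.add_sum_erase _ _ (Finset.mem_univ k), hkt,
    Finset.sum_congr rfl (fun l hl => by rw [hk l (Finset.ne_of_mem_erase hl)]),
    Finset.sum_const, Finset.card_erase_of_mem (Finset.mem_univ k)]
  have : 1 ≤ n := Fin.pos i
  simp [Nat.cast_sub this]

/-- If `t ↦ h |t|` is convex on the real line, then `h` is convex and nondecreasing on
`[0, ∞)`. -/
theorem convexOn_and_monotoneOn_of_convexOn_comp_abs {h : ℝ → ℝ}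
    (hc : ConvexOn ℝ univ fun t : ℝ => h |t|) :
    ConvexOn ℝ (Ici 0) h ∧ MonotoneOn h (Ici 0) := by
  constructor
  · refine (hc.subset (subset_univ _) (convex_Ici 0)).congr fun x hx => ?_
    simp [abs_of_nonneg (show (0 : ℝ) ≤ x from hx)]
  · intro x hx y hy hxy
    have hx : (0 : ℝ) ≤ x := hx
    have hy : (0 : ℝ) ≤ y := hy
    rcases hy.eq_or_lt with rfl | hy0
    · rw [le_antisymm hxy hx]
    -- `x` is the convex combination of `-y` and `y` with weights `(1 ∓ x / y) / 2`, and `h |·|` has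
    -- the same value `h y` at both ends.
    have h0 : 0 ≤ (1 - x / y) / 2 := by
      have := (div_le_one hy0).mpr hxy
      linarith
    have := hc.2 (mem_univ (-y)) (mem_univ y) h0 (show 0 ≤ (1 + x / y) / 2 by positivity) (by ring)
    have h1 : ((1 - x / y) / 2) • (-y) + ((1 + x / y) / 2) • y = x := by
      simp only [smul_eq_mul]; field_simp; ring
    beta_reduce at this
    rw [h1, abs_neg, abs_of_nonneg hx, abs_of_nonneg hy, smul_eq_mul, smul_eq_mul] at this
    linarith

/-! ### Lipschitz functions as admissible variations. -/

theorem tendsto_eLpNorm_one_sub_of_bounded {α : Type*} [MeasurableSpace α] {μ : Measure α}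
    [IsFiniteMeasure μ] {f : ℕ → α → ℝ} {g : α → ℝ} {M : ℝ}
    (hf : ∀ k, AEStronglyMeasurable (f k) μ) (hg : AEStronglyMeasurable g μ)
    (hM : ∀ k, ∀ᵐ x ∂μ, |f k x - g x| ≤ M)
    (hlim : ∀ᵐ x ∂μ, Tendsto (fun k => f k x) atTop (𝓝 (g x))) :
    Tendsto (fun k => eLpNorm (fun x => f k x - g x) 1 μ) atTop (𝓝 0) := by
  simp only [eLpNorm_one_eq_lintegral_enorm]
  have := tendsto_lintegral_of_dominated_convergence' (μ := μ)
    (F := fun k x => ‖f k x - g x‖ₑ) (f := fun _ => 0) (fun _ => ENNReal.ofReal M)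
    (fun k => ((hf k).sub hg).enorm)
    (fun k => (hM k).mono fun x hx => by
      simp only [Real.enorm_eq_ofReal_abs]
      exact ENNReal.ofReal_le_ofReal hx)
    (by simp [ENNReal.mul_eq_top])
    (hlim.mono fun x hx => by
      have h1 : Tendsto (fun k => f k x - g x) atTop (𝓝 0) := by
        simpa using hx.sub_const (g x)
      simpa using h1.enorm)
  simpa using this

theorem _root_.LipschitzWith.ae_lineDeriv_eq_fderiv {C : NNReal} {u : EuclideanSpace ℝ (Fin n) → ℝ}
    (hu : LipschitzWith C u) (e : EuclideanSpace ℝ (Fin n)) :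
    (fun x => lineDeriv ℝ u x e) =ᵐ[volume] fun x => fderiv ℝ u x e :=
  hu.ae_differentiableAt.mono fun _ hx => hx.lineDeriv_eq_fderiv

/-- Lipschitz functions have their pointwise derivative as weak derivative. -/
theorem setIntegral_mul_partialDeriv_of_lipschitzWith {Ω : Set (EuclideanSpace ℝ (Fin n))}
    {C : NNReal} {u φ : EuclideanSpace ℝ (Fin n) → ℝ} (hu : LipschitzWith C u)
    (hφ : IsTestFunction Ω φ) (j : Fin n) :
    ∫ x in Ω, u x * partialDeriv j φ x = - ∫ x in Ω, partialDeriv j u x * φ x := by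
  have h0 : ∀ x, x ∉ Ω → φ x = 0 := fun x hx =>
    image_eq_zero_of_notMem_tsupport fun h => hx (hφ.tsupport_subset h)
  have h1 : ∀ x, x ∉ Ω → fderiv ℝ φ x = 0 := fun x hx => by
    by_contra h
    exact hx (hφ.tsupport_subset (support_fderiv_subset ℝ (Function.mem_support.2 h)))
  rw [setIntegral_eq_integral_of_forall_compl_eq_zero fun x hx => by simp [partialDeriv, h1 x hx],
    setIntegral_eq_integral_of_forall_compl_eq_zero fun x hx => by simp [h0 x hx]]
  obtain ⟨D, hD⟩ := hφ.smooth.lipschitzWith_of_hasCompactSupport hφ.hasCompactSupport (by simp)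
  have key := hu.integral_lineDeriv_mul_eq (μ := volume) hD hφ.hasCompactSupport
    (EuclideanSpace.single j (1 : ℝ))
  have h2 : ∫ x, partialDeriv j u x * φ x =
      ∫ x, lineDeriv ℝ u x (EuclideanSpace.single j (1 : ℝ)) * φ x := by
    refine integral_congr_ae ?_
    filter_upwards [hu.ae_lineDeriv_eq_fderiv (EuclideanSpace.single j (1 : ℝ))] with x hx
    rw [hx, partialDeriv]
  rw [h2, key, ← integral_neg]
  refine integral_congr_ae (Eventually.of_forall fun x => ?_)
  have hd : DifferentiableAt ℝ φ x := hφ.smooth.differentiable (by simp) x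
  simp only [hd.lineDeriv_eq_fderiv, partialDeriv, map_neg]
  ring

/-- The derivative first falls on the smooth kernel; integration by parts for Lipschitz functions
moves it to `u`. The sign cancels against that of the reflection `y ↦ x - y`. -/
theorem fderiv_convolution_of_lipschitzWith {C : NNReal} {ρ u : EuclideanSpace ℝ (Fin n) → ℝ}
    (hρ : ContDiff ℝ 1 ρ) (hρc : HasCompactSupport ρ) (hu : LipschitzWith C u)
    (x e : EuclideanSpace ℝ (Fin n)) :
    fderiv ℝ (ρ ⋆[ContinuousLinearMap.lsmul ℝ ℝ, volume] u) x e =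
      (ρ ⋆[ContinuousLinearMap.lsmul ℝ ℝ, volume] fun y => lineDeriv ℝ u y e) x := by
  have hui : LocallyIntegrable u volume := hu.continuous.locallyIntegrable
  have h1 : (ρ ⋆[ContinuousLinearMap.lsmul ℝ ℝ, volume] u) =
      (u ⋆[(ContinuousLinearMap.lsmul ℝ ℝ).flip, volume] ρ) := by
    rw [convolution_flip]
  rw [h1, (hρc.hasFDerivAt_convolution_right _ hui hρ x).fderiv,
    convolution_precompR_apply _ hui (hρc.fderiv ℝ) (hρ.continuous_fderiv (by simp)),
    ← convolution_flip]
  simp only [convolution_def, ContinuousLinearMap.lsmul_apply, ContinuousLinearMap.flip_apply,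
    smul_eq_mul]
  have hρx : ContDiff ℝ 1 fun y => ρ (x - y) := hρ.comp (contDiff_const.sub contDiff_id)
  have hρxc : HasCompactSupport fun y => ρ (x - y) :=
    hρc.comp_homeomorph (Homeomorph.subLeft x)
  obtain ⟨D, hD⟩ := hρx.lipschitzWith_of_hasCompactSupport hρxc (by simp)
  have key := hu.integral_lineDeriv_mul_eq (μ := volume) hD hρxc e
  have h2 : ∀ y, lineDeriv ℝ (fun y => ρ (x - y)) y (-e) = fderiv ℝ ρ (x - y) e := by
    intro y
    have hd : HasFDerivAt (fun y => ρ (x - y))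
        ((fderiv ℝ ρ (x - y)).comp (-ContinuousLinearMap.id ℝ _)) y :=
      ((hρ.differentiable (by simp) (x - y)).hasFDerivAt).comp y
        ((hasFDerivAt_id y).const_sub x)
    rw [(hd.hasLineDerivAt (-e)).lineDeriv]
    simp
  simp only [h2] at key
  have h3 := integral_sub_left_eq_self (fun y => lineDeriv ℝ u y e * ρ (x - y)) volume x
  have h4 := integral_sub_left_eq_self (fun y => fderiv ℝ ρ (x - y) e * u y) volume x
  simp only [sub_sub_cancel] at h3 h4
  rw [key, ← h4] at h3
  simp only [mul_comm (ρ _), h3]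

/-- Lowering `u` by `1 / (k + 1)` and truncating at zero leaves room to mollify without leaving `Ω`.
Near a fixed point of `Ω` the truncation is eventually inactive, so the derivatives converge at
Lebesgue points of the derivative of `u`; the Lipschitz bound provides domination. -/
theorem exists_testFunction_tendsto {Ω : Set (EuclideanSpace ℝ (Fin n))}
    (hΩ : Bornology.IsBounded Ω) {C : NNReal} {u : EuclideanSpace ℝ (Fin n) → ℝ}
    (hu : LipschitzWith C u) (hpos : ∀ x ∈ Ω, 0 < u x) (hzero : ∀ x, x ∉ Ω → u x = 0) :
    ∃ φ : ℕ → EuclideanSpace ℝ (Fin n) → ℝ, (∀ k, IsTestFunction Ω (φ k)) ∧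
      Tendsto (fun k => eLpNorm (fun x => φ k x - u x) 1 (volume.restrict Ω)) atTop (𝓝 0) ∧
      ∀ j, Tendsto (fun k => eLpNorm (fun x => partialDeriv j (φ k) x - partialDeriv j u x) 1
        (volume.restrict Ω)) atTop (𝓝 0) := by
  have hΩm : MeasurableSet Ω := by
    have : Ω = {x | 0 < u x} := by
      ext x
      refine ⟨hpos x, fun h => ?_⟩
      by_contra hx
      exact (lt_irrefl (0 : ℝ)) (by simp [hzero x hx] at h)
    rw [this]
    exact measurableSet_lt measurable_const hu.continuous.measurable
  have hfin : IsFiniteMeasure (volume.restrict Ω) :=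
    isFiniteMeasure_restrict.2 hΩ.measure_lt_top.ne
  have hu0 : ∀ x, 0 ≤ u x := fun x => by
    by_cases hx : x ∈ Ω
    · exact (hpos x hx).le
    · exact (hzero x hx).ge
  -- Over a ball of radius `ε k`, `u` varies by at most half the truncation level; `C + 1` avoids
  -- dividing by zero.
  let ε : ℕ → ℝ := fun k => 1 / (2 * (k + 1) * (C + 1))
  have hε : ∀ k, 0 < ε k := fun k => by positivity
  have hCε : ∀ k, C * ε k ≤ 1 / (2 * (k + 1)) := fun k => by
    simp only [ε]
    rw [mul_one_div, div_le_div_iff₀ (by positivity) (by positivity)]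
    have : (0 : ℝ) ≤ C := C.2
    nlinarith [Nat.cast_nonneg (α := ℝ) k]
  have hk : ∀ k : ℕ, (1 : ℝ) / (2 * (k + 1)) < 1 / (k + 1) := fun k =>
    one_div_lt_one_div_of_lt (by positivity) (by linarith [Nat.cast_nonneg (α := ℝ) k])
  have hεlim : Tendsto ε atTop (𝓝 0) := by
    have h1 : Tendsto (fun k : ℕ => (1 / ((k : ℝ) + 1)) * (1 / (2 * ((C : ℝ) + 1)))) atTop
        (𝓝 (0 * (1 / (2 * ((C : ℝ) + 1))))) :=
      tendsto_one_div_add_atTop_nhds_zero_nat.mul_const _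
    rw [zero_mul] at h1
    refine h1.congr fun k => ?_
    simp only [ε]
    field_simp
  let ψ : ℕ → ContDiffBump (0 : EuclideanSpace ℝ (Fin n)) := fun k =>
    ⟨ε k / 2, ε k, half_pos (hε k), half_lt_self (hε k)⟩
  let v : ℕ → EuclideanSpace ℝ (Fin n) → ℝ := fun k x => max (u x - 1 / (k + 1)) 0
  have hv : ∀ k, LipschitzWith C (v k) := fun k =>
    (LipschitzWith.of_dist_le_mul fun x y => by
      simpa using hu.dist_le_mul x y : LipschitzWith C fun x => u x - 1 / ((k : ℝ) + 1)).max_const 0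
  let φ : ℕ → EuclideanSpace ℝ (Fin n) → ℝ := fun k =>
    (ψ k).normed volume ⋆[ContinuousLinearMap.lsmul ℝ ℝ, volume] v k
  have hdist : ∀ k x y, y ∈ Metric.ball x (ε k) → |u y - u x| ≤ 1 / (2 * (k + 1)) := by
    intro k x y hy
    have := hu.dist_le_mul y x
    rw [Real.dist_eq] at this
    exact this.trans ((mul_le_mul_of_nonneg_left (Metric.mem_ball.1 hy).le C.2).trans (hCε k))
  have hsmooth : ∀ k, ContDiff ℝ ∞ (φ k) := fun k =>
    HasCompactSupport.contDiff_convolution_left _ (ψ k).hasCompactSupport_normed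
      (ψ k).contDiff_normed (hv k).continuous.locallyIntegrable
  have hsupp : ∀ k, tsupport (φ k) ⊆ {x | 1 / (2 * ((k : ℝ) + 1)) ≤ u x} := by
    intro k
    refine closure_minimal (fun x hx => ?_) (isClosed_le continuous_const hu.continuous)
    by_contra hlt
    rw [mem_ofPred_eq, not_le] at hlt
    have hzero' : ∀ y ∈ Metric.ball x (ψ k).rOut, v k y = 0 := by
      intro y hy
      have := (abs_le.1 (hdist k x y hy)).2
      have h3 : (1 : ℝ) / (2 * (k + 1)) + 1 / (2 * (k + 1)) = 1 / (k + 1) := by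
        field_simp; norm_num
      exact max_eq_right (by linarith)
    refine hx ?_
    have hx0 := hzero' x (Metric.mem_ball_self (hε k))
    have := (ψ k).normed_convolution_eq_right (μ := volume) (x₀ := x) (g := v k)
      (fun y hy => by rw [hzero' y hy, hx0])
    rw [hx0] at this
    exact this
  have hsuppΩ : ∀ k, tsupport (φ k) ⊆ Ω := fun k x hx => by
    by_contra hxΩ
    have h1 : (1 : ℝ) / (2 * (k + 1)) ≤ u x := hsupp k hx
    rw [hzero x hxΩ] at h1
    have : (0 : ℝ) < 1 / (2 * (k + 1)) := by positivity
    linarith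
  have htest : ∀ k, IsTestFunction Ω (φ k) := fun k =>
    ⟨hsmooth k, Metric.isCompact_of_isClosed_isBounded (isClosed_tsupport _)
      (hΩ.subset (hsuppΩ k)), hsuppΩ k⟩
  have happrox : ∀ k x, |φ k x - u x| ≤ 2 * (1 / ((k : ℝ) + 1)) := by
    intro k x
    have h1 : |φ k x - v k x| ≤ 1 / (2 * (k + 1)) := by
      rw [← Real.dist_eq]
      refine (ψ k).dist_normed_convolution_le (hv k).continuous.aestronglyMeasurable
        fun y hy => ?_
      exact ((hv k).dist_le_mul y x).trans
        ((mul_le_mul_of_nonneg_left (Metric.mem_ball.1 hy).le C.2).trans (hCε k))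
    have h2 : |v k x - u x| ≤ 1 / (k + 1) := by
      have h0 : (0 : ℝ) < 1 / (k + 1) := by positivity
      have := hu0 x
      simp only [v]
      rcases max_cases (u x - 1 / ((k : ℝ) + 1)) 0 with h | h <;> rw [h.1, abs_le] <;>
        constructor <;> linarith
    have := hk k
    calc |φ k x - u x| ≤ |φ k x - v k x| + |v k x - u x| := abs_sub_le _ _ _
      _ ≤ _ := by linarith
  refine ⟨φ, htest, ?_, fun j => ?_⟩
  · refine tendsto_eLpNorm_one_sub_of_bounded (M := 2)
      (fun k => (hsmooth k).continuous.aestronglyMeasurable) hu.continuous.aestronglyMeasurable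
      (fun k => Eventually.of_forall fun x => (happrox k x).trans ?_)
      (Eventually.of_forall fun x => ?_)
    · have : (1 : ℝ) / (k + 1) ≤ 1 := by
        rw [div_le_one (by positivity)]; linarith [Nat.cast_nonneg (α := ℝ) k]
      linarith
    · rw [tendsto_iff_dist_tendsto_zero]
      refine squeeze_zero (fun _ => dist_nonneg) (fun k => happrox k x) ?_
      simpa using tendsto_one_div_add_atTop_nhds_zero_nat (𝕜 := ℝ) |>.const_mul 2
  · set e := EuclideanSpace.single j (1 : ℝ)
    have hnorm : ‖e‖ = 1 := by simp [e]
    have hderiv : ∀ k x, partialDeriv j (φ k) x =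
        ((ψ k).normed volume ⋆[ContinuousLinearMap.lsmul ℝ ℝ, volume]
          fun y => lineDeriv ℝ (v k) y e) x := fun k x =>
      fderiv_convolution_of_lipschitzWith (ψ k).contDiff_normed (ψ k).hasCompactSupport_normed
        (hv k) x e
    have hbound : ∀ k x, |partialDeriv j (φ k) x| ≤ C := by
      intro k x
      rw [hderiv, ← Real.norm_eq_abs, ← dist_zero_right]
      refine dist_convolution_le C.2 (ψ k).support_normed_eq.subset (ψ k).nonneg_normed
        (ψ k).integral_normed (measurable_lineDeriv (hv k).continuous).aestronglyMeasurable
        fun y _ => ?_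
      rw [dist_zero_right]
      simpa [hnorm] using norm_lineDeriv_le_of_lipschitz ℝ (hv k) (x₀ := y) (v := e)
    have hbound' : ∀ x, |partialDeriv j u x| ≤ C := fun x => by
      have h1 := (fderiv ℝ u x).le_opNorm e
      rw [hnorm, mul_one] at h1
      exact h1.trans (norm_fderiv_le_of_lipschitz ℝ hu)
    refine tendsto_eLpNorm_one_sub_of_bounded (M := C + C)
      (fun k => (measurable_fderiv_apply_const ℝ _ _).aestronglyMeasurable)
      (measurable_fderiv_apply_const ℝ _ _).aestronglyMeasurable
      (fun k => Eventually.of_forall fun x => (abs_sub _ _).trans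
        (add_le_add (hbound k x) (hbound' x))) ?_
    rw [ae_restrict_iff' hΩm]
    have hloc : LocallyIntegrable (fun y => lineDeriv ℝ u y e) volume :=
      hu.locallyIntegrable_lineDeriv e
    have hleb := ContDiffBump.ae_convolution_tendsto_right_of_locallyIntegrable (φ := ψ)
      (K := 2) (l := atTop) hεlim
      (Eventually.of_forall fun k => by simp only [ψ]; linarith) hloc
    filter_upwards [hleb, hu.ae_lineDeriv_eq_fderiv e] with x hx hxd hxΩ
    change Tendsto _ _ (𝓝 (fderiv ℝ u x e))
    rw [← hxd]
    refine hx.congr' ?_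
    -- Then `u` exceeds the truncation level `1 / (k + 1)` on the whole ball of radius `ε k` about
    -- `x`.
    have h2 : ∀ᶠ k : ℕ in atTop, 2 * (1 / ((k : ℝ) + 1)) < u x := by
      have : Tendsto (fun k : ℕ => 2 * (1 / ((k : ℝ) + 1))) atTop (𝓝 0) := by
        simpa using tendsto_one_div_add_atTop_nhds_zero_nat (𝕜 := ℝ) |>.const_mul 2
      exact this.eventually_lt_const (hpos x hxΩ)
    filter_upwards [h2] with k hk2
    rw [hderiv]
    simp only [convolution_def]
    refine integral_congr_ae (Eventually.of_forall fun t => ?_)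
    by_cases ht : t ∈ Metric.ball 0 (ε k)
    · have hty : x - t ∈ Metric.ball x (ε k) := by simpa using ht
      have heq : v k =ᶠ[𝓝 (x - t)] fun y => u y - 1 / ((k : ℝ) + 1) := by
        filter_upwards [Metric.isOpen_ball.mem_nhds hty] with y hy
        have := (abs_le.1 (hdist k x y hy)).1
        have := hk k
        exact max_eq_left (by linarith)
      have : lineDeriv ℝ (v k) (x - t) e = lineDeriv ℝ u (x - t) e := by
        rw [heq.lineDeriv_eq]
        simp [lineDeriv]
      simp only [this]
    · have : (ψ k).normed volume t = 0 := by
        by_contra h0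
        exact ht ((ψ k).support_normed_eq.subset h0)
      simp [this]

/-- A Lipschitz function that is positive exactly on the bounded set `Ω`, placed in the `i`-th
component, is an admissible variation. -/
theorem memSobolevZeroInfty_of_lipschitzWith {Ω : Set (EuclideanSpace ℝ (Fin n))}
    (hΩ : Bornology.IsBounded Ω) {C : NNReal} {u : EuclideanSpace ℝ (Fin n) → ℝ}
    (hu : LipschitzWith C u) (hpos : ∀ x ∈ Ω, 0 < u x) (hzero : ∀ x, x ∉ Ω → u x = 0)
    (i : Fin n) :
    MemSobolevZeroInfty Ω (fun x => EuclideanSpace.single i (u x))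
      (fun x => Matrix.of fun i' j => if i' = i then partialDeriv j u x else 0) := by
  obtain ⟨R, hR⟩ := hΩ.subset_closedBall (0 : EuclideanSpace ℝ (Fin n))
  obtain ⟨B, hB⟩ := (isCompact_closedBall (0 : EuclideanSpace ℝ (Fin n)) R).exists_bound_of_continuousOn
    hu.continuous.continuousOn
  have hB' : ∀ x, ‖u x‖ ≤ max B 0 := fun x => by
    by_cases hx : x ∈ Ω
    · exact (hB x (hR hx)).trans (le_max_left _ _)
    · simp [hzero x hx]
  obtain ⟨φ, hφ, hφ0, hφ1⟩ := exists_testFunction_tendsto hΩ hu hpos hzero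
  refine ⟨⟨fun i' => ?_, fun i' j => ?_, fun ψ hψ i' j => ?_⟩,
    fun k i' => if i' = i then φ k else 0, fun k i' => ?_, fun i' => ?_, fun i' j => ?_⟩
  all_goals by_cases hi : i' = i
  all_goals simp only [hi, if_true, if_false, Matrix.of_apply, PiLp.single_apply]
  · exact memLp_top_of_bound hu.continuous.aestronglyMeasurable _ (Eventually.of_forall hB')
  · exact MemLp.zero'
  · refine memLp_top_of_bound (measurable_fderiv_apply_const ℝ _ _).aestronglyMeasurable C
      (Eventually.of_forall fun x => ?_)
    have h1 := (fderiv ℝ u x).le_opNorm (EuclideanSpace.single j (1 : ℝ))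
    rw [PiLp.norm_single, norm_one, mul_one] at h1
    exact h1.trans (norm_fderiv_le_of_lipschitz ℝ hu)
  · exact MemLp.zero'
  · exact setIntegral_mul_partialDeriv_of_lipschitzWith hu hψ j
  · simp
  · exact hφ k
  · exact ⟨contDiff_const, HasCompactSupport.zero, by simp⟩
  · exact hφ0
  · simp
  · exact hφ1 j
  · simp [partialDeriv]

/-! ### Consequences of convexity of `W`. -/

/-- Derivatives of test functions integrate to zero (integration by parts against the constant 1),
and this passes to the `L¹` limit. -/
theorem setIntegral_grad_eq_zero {Ω : Set (EuclideanSpace ℝ (Fin n))}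
    (hΩ : Bornology.IsBounded Ω) {θ : EuclideanSpace ℝ (Fin n) → EuclideanSpace ℝ (Fin n)}
    {G : EuclideanSpace ℝ (Fin n) → Matrix (Fin n) (Fin n) ℝ} (h : MemSobolevZeroInfty Ω θ G)
    (i j : Fin n) :
    IntegrableOn (fun x => G x i j) Ω ∧ ∫ x in Ω, G x i j = 0 := by
  have hfin : IsFiniteMeasure (volume.restrict Ω) :=
    isFiniteMeasure_restrict.2 hΩ.measure_lt_top.ne
  have hG : Integrable (fun x => G x i j) (volume.restrict Ω) :=
    (h.1.memLp_grad i j).integrable le_top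
  refine ⟨hG, ?_⟩
  obtain ⟨φ, hφ, -, hφ1⟩ := h.2
  have hint : ∀ k, Integrable (fun x => partialDeriv j (φ k i) x) := fun k =>
    (((hφ k i).smooth.continuous_fderiv (by simp)).clm_apply continuous_const).integrable_of_hasCompactSupport
      ((hφ k i).hasCompactSupport.fderiv_apply ℝ _)
  have hφint : ∀ k, Integrable (φ k i) := fun k =>
    (hφ k i).smooth.continuous.integrable_of_hasCompactSupport (hφ k i).hasCompactSupport
  have hzero : ∀ k, ∫ x in Ω, partialDeriv j (φ k i) x = 0 := by
    intro k
    have h1 : ∀ x, x ∉ Ω → fderiv ℝ (φ k i) x = 0 := fun x hx => by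
      by_contra h
      exact hx ((hφ k i).tsupport_subset (support_fderiv_subset ℝ (Function.mem_support.2 h)))
    rw [setIntegral_eq_integral_of_forall_compl_eq_zero fun x hx => by simp [partialDeriv, h1 x hx]]
    have := integral_mul_fderiv_eq_neg_fderiv_mul_of_integrable (μ := volume)
      (f := fun _ : EuclideanSpace ℝ (Fin n) => (1 : ℝ)) (g := φ k i)
      (v := EuclideanSpace.single j (1 : ℝ)) (by simp) ((hint k).congr (Eventually.of_forall fun x => (one_mul _).symm)) (by simpa only [one_mul] using hφint k)
      (fun _ _ => differentiableAt_const _)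
      (fun x _ => (hφ k i).smooth.differentiable (by simp) x)
    simpa [partialDeriv] using this
  have hlim := tendsto_integral_of_L1' _ hG.aestronglyMeasurable
    (Eventually.of_forall fun k => (hint k).integrableOn) (hφ1 i j)
  simp only [hzero] at hlim
  exact (tendsto_nhds_unique hlim tendsto_const_nhds).trans rfl

theorem _root_.MeasureTheory.Integrable.integralExists {α : Type*} [MeasurableSpace α]
    {μ : Measure α} {f : α → ℝ} (hf : Integrable f μ) : IntegralExists f μ :=
  ⟨hf.aemeasurable, Or.inl hf.lintegral_lt_top.ne⟩

theorem extIntegral_eq_integral {α : Type*} [MeasurableSpace α] {μ : Measure α} {f : α → ℝ}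
    (hf : Integrable f μ) : extIntegral f μ = ((∫ x, f x ∂μ : ℝ) : EReal) := by
  rw [extIntegral, integral_eq_lintegral_pos_part_sub_lintegral_neg_part hf, EReal.coe_sub,
    EReal.coe_ennreal_toReal hf.lintegral_lt_top.ne,
    EReal.coe_ennreal_toReal (show ∫⁻ x, ENNReal.ofReal (-f x) ∂μ ≠ ⊤ from
      hf.neg.lintegral_lt_top.ne)]

/-- Jensen for the mean-zero gradient. A convex function in finite dimension is continuous, so the
integrand is bounded almost everywhere. -/
theorem quasiconvex_of_convexOn {W : Matrix (Fin n) (Fin n) ℝ → ℝ} (hW : ConvexOn ℝ univ W) :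
    Quasiconvex W := by
  intro Ω _ hΩ _ F θ G hG _
  have hfin : IsFiniteMeasure (volume.restrict Ω) :=
    isFiniteMeasure_restrict.2 hΩ.measure_lt_top.ne
  let g : (Fin n → Fin n → ℝ) → ℝ := fun A => W (F + Matrix.of A)
  have hg : ConvexOn ℝ univ g := by
    have := hW.translate_right F
    exact this
  have hgc : Continuous g := hg.locallyLipschitz.continuous
  let G' : EuclideanSpace ℝ (Fin n) → Fin n → Fin n → ℝ := fun x i j => G x i j
  have hint := fun i j => (setIntegral_grad_eq_zero hΩ hG i j).1
  have hrow : ∀ i, Integrable (fun x => G' x i) (volume.restrict Ω) := fun i =>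
    Integrable.of_eval (hint i)
  have hG' : Integrable G' (volume.restrict Ω) := Integrable.of_eval hrow
  have hzero : ∫ x in Ω, G' x = 0 := by
    ext i j
    rw [eval_integral hrow, eval_integral (hint i)]
    exact (setIntegral_grad_eq_zero hΩ hG i j).2
  have hbdd : ∀ i j, ∃ C : ℝ, ∀ᵐ x ∂volume.restrict Ω, ‖G x i j‖ ≤ C := fun i j =>
    ⟨_, ae_le_lpNorm_exponent_top (hG.1.memLp_grad i j)⟩
  choose C hC using hbdd
  have hmem : ∀ᵐ x ∂volume.restrict Ω,
      G' x ∈ (univ.pi fun i => univ.pi fun j => Icc (-C i j) (C i j)) := by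
    simp only [mem_univ_pi]
    refine ae_all_iff.2 fun i => ae_all_iff.2 fun j => ?_
    filter_upwards [hC i j] with x hx
    exact abs_le.1 hx
  obtain ⟨B, hB⟩ := (isCompact_univ_pi fun i => isCompact_univ_pi fun j =>
    isCompact_Icc (a := -C i j) (b := C i j)).exists_bound_of_continuousOn hgc.continuousOn
  have hgi : Integrable (fun x => g (G' x)) (volume.restrict Ω) :=
    Integrable.of_bound (hgc.comp_aestronglyMeasurable hG'.aestronglyMeasurable) B
      (hmem.mono fun x hx => hB _ hx)
  rw [show (fun x => W (F + G x)) = fun x => g (G' x) from rfl, extIntegral_eq_integral hgi,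
    EReal.coe_le_coe_iff]
  by_cases h0 : volume Ω = 0
  · simp [h0, Measure.restrict_eq_zero.2 h0]
  · have hne : NeZero (volume.restrict Ω) := ⟨by simpa using h0⟩
    have := hg.map_average_le hgc.continuousOn isClosed_univ (by simp) hG' hgi
    rw [average_eq, average_eq, hzero, smul_zero] at this
    have hg0 : g 0 = W F := by simp [g]
    have hpos : 0 < (volume Ω).toReal := ENNReal.toReal_pos h0 hΩ.measure_lt_top.ne
    rw [hg0, Measure.real, Measure.restrict_apply_univ, smul_eq_mul, inv_mul_eq_div,
      le_div_iff₀ hpos] at this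
    rw [mul_comm]
    exact this

theorem polyconvex_of_convexOn (hn : 1 ≤ n) {W : Matrix (Fin n) (Fin n) ℝ → ℝ}
    (hW : ConvexOn ℝ univ W) : Polyconvex W := by
  -- Label `0` stands for order one, so the entries of `F` can be read off linearly from its minors
  -- by `L`.
  let e : Fin n → (Fin (((⟨0, hn⟩ : Fin n) : ℕ) + 1) ↪o Fin n) := fun i =>
    OrderEmbedding.ofStrictMono (fun _ => i) fun a b hab => by
      have ha : (a : ℕ) < 0 + 1 := a.2
      have hb : (b : ℕ) < 0 + 1 := b.2
      have : (a : ℕ) < b := hab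
      omega
  let L : (MinorIndex n → ℝ) →ₗ[ℝ] Matrix (Fin n) (Fin n) ℝ :=
    { toFun := fun m => Matrix.of fun i j => m ⟨⟨0, hn⟩, e i, e j⟩
      map_add' := fun _ _ => rfl
      map_smul' := fun _ _ => rfl }
  refine ⟨fun m => W (L m), hW.comp_linearMap L, fun F => congrArg W ?_⟩
  ext i j
  change F i j = (F.submatrix (e i) (e j)).det
  have : Unique (Fin (((⟨0, hn⟩ : Fin n) : ℕ) + 1)) := inferInstanceAs (Unique (Fin 1))
  rw [Matrix.det_unique]
  rfl

theorem rankOneConvex_of_convexOn {W : Matrix (Fin n) (Fin n) ℝ → ℝ} (hW : ConvexOn ℝ univ W) :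
    RankOneConvex W := fun F₁ F₂ _ t ht =>
  hW.2 (mem_univ F₁) (mem_univ F₂) (sub_nonneg.2 ht.2) ht.1 (by ring)

/-! ### Restricting rank-one convexity and polyconvexity to the diagonal line. -/

theorem RankOneConvex.convexOn_smul_single {W : Matrix (Fin n) (Fin n) ℝ → ℝ}
    (hW : RankOneConvex W) (i : Fin n) :
    ConvexOn ℝ univ fun t : ℝ => W (t • Matrix.single i i (1 : ℝ)) := by
  refine LinearOrder.convexOn_of_lt convex_univ fun x _ y _ hxy a b ha hb hab => ?_
  have hrank : (y • Matrix.single i i (1 : ℝ) - x • Matrix.single i i (1 : ℝ)).rank = 1 := by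
    have hv : y • Matrix.single i i (1 : ℝ) - x • Matrix.single i i (1 : ℝ) =
        Matrix.diagonal (Pi.single i (y - x)) := by
      rw [← sub_smul, Matrix.smul_single, smul_eq_mul, mul_one, Matrix.diagonal_single]
    rw [hv, Matrix.rank_diagonal]
    have : ∀ k, (Pi.single i (y - x) : Fin n → ℝ) k ≠ 0 ↔ k = i := fun k => by
      by_cases hk : k = i
      · subst hk; simpa using (sub_pos.2 hxy).ne'
      · simp [hk]
    simp [this]
  have := hW _ _ hrank b ⟨hb.le, by linarith⟩
  rw [show 1 - b = a by linarith] at this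
  simpa only [add_smul, smul_smul, smul_eq_mul] using this

/-- Minors of order at least two contain a zero row and vanish, so along this line the vector of
minors is linear in `t`. -/
theorem minors_smul_single (i : Fin n) (t : ℝ) :
    minors (t • Matrix.single i i (1 : ℝ)) = t • minors (Matrix.single i i (1 : ℝ)) := by
  ext ⟨k, r, c⟩
  simp only [minors, Pi.smul_apply, smul_eq_mul, Matrix.submatrix_smul, Matrix.det_smul,
    Fintype.card_fin]
  rcases Nat.eq_zero_or_pos (k : ℕ) with hk | hk
  · simp [hk]
  · have : Nontrivial (Fin ((k : ℕ) + 1)) := Fin.nontrivial_iff_two_le.2 (by omega)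
    have hdet : ((Matrix.single i i (1 : ℝ)).submatrix r c).det = 0 := by
      obtain ⟨l, hl⟩ : ∃ l, r l ≠ i := by
        by_contra! h
        obtain ⟨a, b, hab⟩ := exists_pair_ne (Fin ((k : ℕ) + 1))
        exact hab (r.injective ((h a).trans (h b).symm))
      refine Matrix.det_eq_zero_of_row_eq_zero l fun j => ?_
      simp [hl.symm]
    simp [hdet]

theorem Polyconvex.convexOn_smul_single {W : Matrix (Fin n) (Fin n) ℝ → ℝ}
    (hW : Polyconvex W) (i : Fin n) :
    ConvexOn ℝ univ fun t : ℝ => W (t • Matrix.single i i (1 : ℝ)) := by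
  obtain ⟨g, hg, hWg⟩ := hW
  simp only [hWg, minors_smul_single]
  exact hg.comp_linearMap (LinearMap.toSpanSingleton ℝ _ (minors (Matrix.single i i (1 : ℝ))))

/-! ### Roof functions over boxes. -/

/-- The open box `∏ (aₖ, bₖ)` in Euclidean space. -/
def openBox (a b : Fin n → ℝ) : Set (EuclideanSpace ℝ (Fin n)) :=
  WithLp.ofLp ⁻¹' (univ.pi fun k => Ioo (a k) (b k))

theorem mem_openBox {a b : Fin n → ℝ} {x : EuclideanSpace ℝ (Fin n)} :
    x ∈ openBox a b ↔ ∀ k, a k < x k ∧ x k < b k := by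
  simp [openBox]

theorem isOpen_openBox (a b : Fin n → ℝ) : IsOpen (openBox a b) :=
  (isOpen_set_pi finite_univ fun _ _ => isOpen_Ioo).preimage (PiLp.continuous_ofLp 2 _)

theorem convex_openBox (a b : Fin n → ℝ) : Convex ℝ (openBox a b) :=
  (convex_pi fun _ _ => convex_Ioo _ _).linear_preimage
    (WithLp.linearEquiv 2 ℝ (Fin n → ℝ)).toLinearMap

theorem isBounded_openBox (a b : Fin n → ℝ) : Bornology.IsBounded (openBox a b) := by
  have : IsCompact (WithLp.toLp 2 '' (univ.pi fun k => Icc (a k) (b k))) :=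
    (isCompact_univ_pi fun k => isCompact_Icc).image (PiLp.continuous_toLp 2 _)
  refine this.isBounded.subset fun x hx => ⟨WithLp.ofLp x, fun k _ => ?_, rfl⟩
  exact ⟨(mem_openBox.1 hx k).1.le, (mem_openBox.1 hx k).2.le⟩

theorem volume_openBox_toReal {a b : Fin n → ℝ} (h : a ≤ b) :
    (volume (openBox a b)).toReal = ∏ k, (b k - a k) := by
  rw [openBox, (PiLp.volume_preserving_ofLp (Fin n)).measure_preimage
    (MeasurableSet.univ_pi fun k => measurableSet_Ioo).nullMeasurableSet,
    Real.volume_pi_Ioo_toReal h]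

/-- The slopes of the roof function `roof`: `α` and `-β` in the direction `i`, and `±1` in the
other directions. -/
def roofSlope (i : Fin n) (α β : ℝ) (q : Fin n × Bool) : ℝ :=
  if q.1 = i then (if q.2 then α else -β) else (if q.2 then 1 else -1)

/-- The affine pieces of the roof function. -/
def roofPiece (i : Fin n) (α β δ : ℝ) (q : Fin n × Bool) (x : EuclideanSpace ℝ (Fin n)) : ℝ :=
  (if q.1 = i then δ else 1) + roofSlope i α β q * x q.1

theorem roofIndex_nonempty (i : Fin n) : (Finset.univ : Finset (Fin n × Bool)).Nonempty :=
  ⟨(i, true), Finset.mem_univ _⟩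

/-- The minimum of the affine functions `roofPiece`. -/
def roofMin (i : Fin n) (α β δ : ℝ) (x : EuclideanSpace ℝ (Fin n)) : ℝ :=
  Finset.univ.inf' (roofIndex_nonempty i) fun q => roofPiece i α β δ q x

/-- The positive part of the minimum of the affine functions `roofPiece`. -/
def roof (i : Fin n) (α β δ : ℝ) (x : EuclideanSpace ℝ (Fin n)) : ℝ :=
  max (roofMin i α β δ x) 0

/-- The lower corner of the support of the roof function, scaled by `r` in the directions other
than `i`. -/
def roofLower (i : Fin n) (α δ r : ℝ) (k : Fin n) : ℝ := if k = i then -(δ / α) else -r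

/-- The upper corner of the support of the roof function, scaled by `r` in the directions other
than `i`. -/
def roofUpper (i : Fin n) (β δ r : ℝ) (k : Fin n) : ℝ := if k = i then δ / β else r

section Roof

variable {i : Fin n} {α β δ : ℝ}

theorem hasFDerivAt_roofPiece (q : Fin n × Bool) (x : EuclideanSpace ℝ (Fin n)) :
    HasFDerivAt (roofPiece i α β δ q)
      (roofSlope i α β q • (EuclideanSpace.proj q.1 : EuclideanSpace ℝ (Fin n) →L[ℝ] ℝ)) x :=
  ((EuclideanSpace.proj q.1 : EuclideanSpace ℝ (Fin n) →L[ℝ] ℝ).hasFDerivAt.const_mul _).const_add _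

theorem exists_lipschitzWith_roof (i : Fin n) (α β δ : ℝ) :
    ∃ C, LipschitzWith C (roof i α β δ) := by
  let C : NNReal := ∑ q, ‖roofSlope i α β q‖₊
  refine ⟨C, LipschitzWith.max_const ?_ 0⟩
  have hmin : roofMin i α β δ = Finset.univ.inf' (roofIndex_nonempty i) (roofPiece i α β δ) := by
    ext x
    rw [roofMin, Finset.inf'_apply]
  rw [hmin]
  refine Finset.inf'_induction (p := LipschitzWith C) _ _ (fun f hf g hg => ?_) fun q _ => ?_
  · exact (hf.min hg).weaken (max_self C).le
  · refine LipschitzWith.of_dist_le_mul fun x y => ?_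
    simp only [roofPiece, dist_add_left, Real.dist_eq, ← mul_sub, abs_mul]
    have h1 : |roofSlope i α β q| ≤ C := by
      have : ‖roofSlope i α β q‖₊ ≤ C :=
        Finset.single_le_sum (f := fun q => ‖roofSlope i α β q‖₊) (fun _ _ => zero_le)
          (Finset.mem_univ q)
      exact_mod_cast this
    have h2 : |x q.1 - y q.1| ≤ dist x y := by
      rw [dist_eq_norm]
      simpa using PiLp.norm_apply_le (x - y) q.1
    exact mul_le_mul h1 h2 (abs_nonneg _) C.2

theorem roofMin_pos_iff {x : EuclideanSpace ℝ (Fin n)} :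
    0 < roofMin i α β δ x ↔ ∀ q, 0 < roofPiece i α β δ q x := by
  simp only [roofMin, Finset.lt_inf'_iff, Finset.mem_univ, true_imp_iff]

theorem forall_roofPiece_pos_iff (hα : 0 < α) (hβ : 0 < β) {x : EuclideanSpace ℝ (Fin n)} :
    (∀ q, 0 < roofPiece i α β δ q x) ↔ x ∈ openBox (roofLower i α δ 1) (roofUpper i β δ 1) := by
  rw [mem_openBox, Prod.forall]
  refine forall_congr' fun k => ?_
  simp only [Bool.forall_bool, roofPiece, roofSlope, roofLower, roofUpper]
  by_cases hk : k = i
  · simp only [hk, if_true, Bool.false_eq_true, if_false]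
    rw [← neg_div, div_lt_iff₀ hα, lt_div_iff₀ hβ]
    constructor <;> rintro ⟨h1, h2⟩ <;> constructor <;> nlinarith
  · simp only [hk, if_true, Bool.false_eq_true, if_false]
    constructor <;> rintro ⟨h1, h2⟩ <;> constructor <;> linarith

theorem roof_pos (hα : 0 < α) (hβ : 0 < β) {x : EuclideanSpace ℝ (Fin n)}
    (hx : x ∈ openBox (roofLower i α δ 1) (roofUpper i β δ 1)) : 0 < roof i α β δ x :=
  lt_max_of_lt_left (roofMin_pos_iff.2 ((forall_roofPiece_pos_iff hα hβ).2 hx))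

theorem roof_eq_zero (hα : 0 < α) (hβ : 0 < β) {x : EuclideanSpace ℝ (Fin n)}
    (hx : x ∉ openBox (roofLower i α δ 1) (roofUpper i β δ 1)) : roof i α β δ x = 0 := by
  refine max_eq_right (not_lt.1 fun h => hx ?_)
  exact (forall_roofPiece_pos_iff hα hβ).1 (roofMin_pos_iff.1 h)

theorem exists_roof_eq (hα : 0 < α) (hβ : 0 < β) {x : EuclideanSpace ℝ (Fin n)}
    (hx : x ∈ openBox (roofLower i α δ 1) (roofUpper i β δ 1)) :
    ∃ q, roof i α β δ x = roofPiece i α β δ q x := by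
  have h := roofMin_pos_iff.2 ((forall_roofPiece_pos_iff hα hβ).2 hx)
  obtain ⟨q, -, hq⟩ := Finset.exists_mem_eq_inf' (s := (Finset.univ : Finset (Fin n × Bool)))
    (roofIndex_nonempty i) fun q => roofPiece i α β δ q x
  exact ⟨q, by rw [roof, max_eq_left h.le, roofMin, hq]⟩

theorem roof_le_roofPiece (hα : 0 < α) (hβ : 0 < β) {x : EuclideanSpace ℝ (Fin n)}
    (hx : x ∈ openBox (roofLower i α δ 1) (roofUpper i β δ 1)) (q : Fin n × Bool) :
    roof i α β δ x ≤ roofPiece i α β δ q x := by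
  have h := roofMin_pos_iff.2 ((forall_roofPiece_pos_iff hα hβ).2 hx)
  rw [roof, max_eq_left h.le]
  exact Finset.inf'_le _ (Finset.mem_univ q)

/-- Where the roof function is differentiable, its gradient is that of any active piece. -/
theorem partialDeriv_roof (hα : 0 < α) (hβ : 0 < β) {x : EuclideanSpace ℝ (Fin n)}
    (hx : x ∈ openBox (roofLower i α δ 1) (roofUpper i β δ 1))
    (hd : DifferentiableAt ℝ (roof i α β δ) x) {q : Fin n × Bool}
    (hq : roof i α β δ x = roofPiece i α β δ q x) (j : Fin n) :
    partialDeriv j (roof i α β δ) x = if j = q.1 then roofSlope i α β q else 0 := by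
  -- The active piece lies above the roof and touches it at `x`, so the difference has zero
  -- derivative there.
  have hmin : IsLocalMin (fun y => roofPiece i α β δ q y - roof i α β δ y) x := by
    filter_upwards [(isOpen_openBox _ _).mem_nhds hx] with y hy
    rw [hq, sub_self]
    exact sub_nonneg.2 (roof_le_roofPiece hα hβ hy q)
  have h0 := hmin.hasFDerivAt_eq_zero ((hasFDerivAt_roofPiece q x).sub hd.hasFDerivAt)
  rw [partialDeriv, ← sub_eq_zero.1 h0]
  simp [eq_comm]

/-- In the inner part of the box only the two pieces in direction `i` are active. -/
theorem fst_eq_of_roof_eq (hα : 0 < α) (hβ : 0 < β) {x : EuclideanSpace ℝ (Fin n)}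
    (hx : x ∈ openBox (roofLower i α δ 1) (roofUpper i β δ 1))
    (hx' : x ∈ openBox (roofLower i α δ (1 - δ)) (roofUpper i β δ (1 - δ))) {q : Fin n × Bool}
    (hq : roof i α β δ x = roofPiece i α β δ q x) : q.1 = i := by
  by_contra hne
  have h1 := roof_le_roofPiece hα hβ hx (i, true)
  have h2 := roof_le_roofPiece hα hβ hx (i, false)
  have h3 := mem_openBox.1 hx' q.1
  rw [hq] at h1 h2
  obtain ⟨k, s⟩ := q
  simp only at hne
  simp only [roofLower, roofUpper, hne, if_false] at h3
  -- In the inner box the pieces of other directions exceed `δ`, while by the sign of `x i` one of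
  -- the two pieces of direction `i` is at most `δ`.
  have h4 : δ < roofPiece i α β δ (k, s) x := by
    cases s <;> simp [roofPiece, roofSlope, hne] <;> linarith
  simp only [roofPiece, roofSlope, if_true, Bool.false_eq_true, if_false] at h1 h2 h4
  rcases le_total 0 (x i) with h | h <;> nlinarith

theorem roofLower_le_roofUpper (hα : 0 < α) (hβ : 0 < β) (hδ : 0 < δ) {r : ℝ} (hr : 0 ≤ r) :
    roofLower i α δ r ≤ roofUpper i β δ r := by
  intro k
  simp only [roofLower, roofUpper]
  have h1 : 0 < δ / α := by positivity
  have h2 : 0 < δ / β := by positivity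
  split_ifs <;> linarith

theorem volume_roof_box (hα : 0 < α) (hβ : 0 < β) (hδ : 0 < δ) {r : ℝ} (hr : 0 ≤ r) :
    (volume (openBox (roofLower i α δ r) (roofUpper i β δ r))).toReal =
      (∏ k, if k = i then 1 else r) *
        (volume (openBox (roofLower i α δ 1) (roofUpper i β δ 1))).toReal := by
  rw [volume_openBox_toReal (roofLower_le_roofUpper hα hβ hδ hr),
    volume_openBox_toReal (roofLower_le_roofUpper hα hβ hδ zero_le_one),
    ← Finset.prod_mul_distrib]
  refine Finset.prod_congr rfl fun k _ => ?_
  simp only [roofLower, roofUpper]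
  split_ifs <;> ring

theorem volume_roof_box_pos (hα : 0 < α) (hβ : 0 < β) (hδ : 0 < δ) :
    0 < (volume (openBox (roofLower i α δ 1) (roofUpper i β δ 1))).toReal := by
  rw [volume_openBox_toReal (roofLower_le_roofUpper hα hβ hδ zero_le_one)]
  refine Finset.prod_pos fun k _ => ?_
  simp only [roofLower, roofUpper]
  split_ifs
  · have h1 : 0 < δ / α := by positivity
    have h2 : 0 < δ / β := by positivity
    linarith
  · norm_num

end Roof

/-! ### Testing quasiconvexity with roofs. -/

/-- The inequality obtained from testing quasiconvexity with a roof function. -/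
theorem Quasiconvex.sub_le_mul {W : Matrix (Fin n) (Fin n) ℝ → ℝ} (hW : Quasiconvex W) (i : Fin n)
    (F : Matrix (Fin n) (Fin n) ℝ) {α β δ A B M : ℝ} (hα : 0 < α) (hβ : 0 < β) (hδ : 0 < δ)
    (hδ1 : δ < 1) (hAα : W (F + Matrix.single i i α) = A + B * α)
    (hAβ : W (F + Matrix.single i i (-β)) = A + B * (-β))
    (hM : ∀ q, |W (F + Matrix.single i q.1 (roofSlope i α β q)) -
      (A + B * if q.1 = i then roofSlope i α β q else 0)| ≤ M) :
    W F - A ≤ M * (1 - ∏ k, if k = i then 1 else (1 - δ)) := by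
  set Ω := openBox (roofLower i α δ 1) (roofUpper i β δ 1) with hΩdef
  set Ω' := openBox (roofLower i α δ (1 - δ)) (roofUpper i β δ (1 - δ)) with hΩ'def
  have hΩb : Bornology.IsBounded Ω := isBounded_openBox _ _
  have hΩm : MeasurableSet Ω := (isOpen_openBox _ _).measurableSet
  have hΩ'm : MeasurableSet Ω' := (isOpen_openBox _ _).measurableSet
  have hfin : IsFiniteMeasure (volume.restrict Ω) :=
    isFiniteMeasure_restrict.2 hΩb.measure_lt_top.ne
  have hsub : Ω' ⊆ Ω := by
    intro x hx
    rw [hΩdef, mem_openBox]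
    intro k
    have := mem_openBox.1 hx k
    simp only [roofLower, roofUpper] at this ⊢
    split_ifs at this ⊢ <;> constructor <;> linarith [this.1, this.2]
  obtain ⟨C, hC⟩ := exists_lipschitzWith_roof i α β δ
  have hθ := memSobolevZeroInfty_of_lipschitzWith hΩb hC (fun x hx => roof_pos hα hβ hx)
    (fun x hx => roof_eq_zero hα hβ hx) i
  set G : EuclideanSpace ℝ (Fin n) → Matrix (Fin n) (Fin n) ℝ :=
    fun x => Matrix.of fun i' j => if i' = i then partialDeriv j (roof i α β δ) x else 0 with hGdef
  have hGq : ∀ᵐ x ∂volume.restrict Ω, ∃ q : Fin n × Bool,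
      G x = Matrix.single i q.1 (roofSlope i α β q) ∧ (x ∈ Ω' → q.1 = i) := by
    rw [ae_restrict_iff' hΩm]
    filter_upwards [hC.ae_differentiableAt] with x hd hx
    obtain ⟨q, hq⟩ := exists_roof_eq hα hβ hx
    refine ⟨q, ?_, fun hx' => fst_eq_of_roof_eq hα hβ hx hx' hq⟩
    ext i' j
    simp only [hGdef, Matrix.of_apply, partialDeriv_roof hα hβ hx hd hq, Matrix.single_apply]
    grind
  have hGm : Measurable fun x => (fun i' j => G x i' j : Fin n → Fin n → ℝ) := by
    refine measurable_pi_lambda _ fun i' => measurable_pi_lambda _ fun j => ?_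
    by_cases hi : i' = i
    · simpa [hGdef, hi, partialDeriv] using measurable_fderiv_apply_const ℝ (roof i α β δ)
        (EuclideanSpace.single j (1 : ℝ))
    · simp [hGdef, hi]
  set S : Set (Fin n → Fin n → ℝ) :=
    range fun q : Fin n × Bool => Matrix.single i q.1 (roofSlope i α β q) with hS
  have hSfin : S.Finite := finite_range _
  -- `W` itself may fail to be measurable, but the gradient lies almost everywhere in the finite set
  -- `S`, so only the cut-off of `W` to `S` matters.
  have hWm : Measurable (S.indicator fun m => W (F + Matrix.of m)) :=
    (measurable_const (a := (0 : ℝ))).measurable_of_countable_ne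
      (hSfin.countable.mono fun m hm => by
        by_contra hmS
        exact hm (indicator_of_notMem hmS _).symm)
  have hfm : AEStronglyMeasurable (fun x => W (F + G x)) (volume.restrict Ω) := by
    refine (hWm.comp hGm).aestronglyMeasurable.congr ?_
    filter_upwards [hGq] with x ⟨q, hq, _⟩
    have : (fun i' j => G x i' j : Fin n → Fin n → ℝ) ∈ S := ⟨q, hq.symm⟩
    simp only [Function.comp, indicator_of_mem this]
    rfl
  have hf : Integrable (fun x => W (F + G x)) (volume.restrict Ω) := by
    refine Integrable.of_bound hfm
      (∑ q : Fin n × Bool, ‖W (F + Matrix.single i q.1 (roofSlope i α β q))‖) ?_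
    filter_upwards [hGq] with x ⟨q, hq, _⟩
    rw [hq]
    exact Finset.single_le_sum
      (f := fun q : Fin n × Bool => ‖W (F + Matrix.single i q.1 (roofSlope i α β q))‖)
      (fun _ _ => norm_nonneg _) (Finset.mem_univ q)
  have hQ := hW Ω (isOpen_openBox _ _) hΩb ((convex_openBox _ _).addHaar_frontier volume) F _ G hθ
    hf.integralExists
  rw [extIntegral_eq_integral hf, EReal.coe_le_coe_iff] at hQ
  -- The mean of `G i i` is zero, so subtracting the affine function `A + B s` costs only `A`.
  obtain ⟨hGi, hGi0⟩ := setIntegral_grad_eq_zero hΩb hθ i i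
  have hLi : Integrable (fun x => A + B * G x i i) (volume.restrict Ω) :=
    (integrable_const A).add (hGi.const_mul B)
  have hL : ∫ x in Ω, (A + B * G x i i) = (volume Ω).toReal * A := by
    rw [integral_add (integrable_const A) (hGi.const_mul B), integral_const_mul, hGi0]
    simp [Measure.real]
  have hind : Integrable ((Ω \ Ω').indicator fun _ => M) (volume.restrict Ω) :=
    (integrable_const M).indicator (hΩm.diff hΩ'm)
  -- On `Ω'` the slopes are `α` and `-β`, where `W` agrees with the affine function; the rest of the
  -- box contributes at most `M` times its volume.
  have hcmp : ∫ x in Ω, (W (F + G x) - (A + B * G x i i)) ≤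
      ∫ x in Ω, (Ω \ Ω').indicator (fun _ => M) x := by
    refine integral_mono_ae (hf.sub hLi) hind ?_
    filter_upwards [hGq, ae_restrict_mem hΩm] with x ⟨q, hq, hqi⟩ hx
    rw [hq]
    by_cases hx' : x ∈ Ω'
    · rw [indicator_of_notMem fun h => h.2 hx']
      obtain ⟨k, s⟩ := q
      have hk : k = i := hqi hx'
      subst hk
      cases s
      · simp [roofSlope, hAβ]
      · simp [roofSlope, hAα]
    · rw [indicator_of_mem ((Set.mem_sdiff x).2 ⟨hx, hx'⟩)]
      refine (le_abs_self _).trans (le_trans (le_of_eq ?_) (hM q))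
      simp [Matrix.single_apply]
  rw [integral_sub hf hLi, hL, integral_indicator (hΩm.diff hΩ'm),
    Measure.restrict_restrict (hΩm.diff hΩ'm), inter_eq_left.2 sdiff_subset] at hcmp
  have hvol : (volume (Ω \ Ω')).toReal =
      (1 - ∏ k, if k = i then 1 else (1 - δ)) * (volume Ω).toReal := by
    rw [measure_sdiff hsub hΩ'm.nullMeasurableSet
      (measure_ne_top_of_subset hsub hΩb.measure_lt_top.ne),
      ENNReal.toReal_sub_of_le (measure_mono hsub) hΩb.measure_lt_top.ne,
      volume_roof_box hα hβ hδ (sub_nonneg.2 hδ1.le)]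
    ring
  have hconst : ∫ _ in Ω \ Ω', M = (volume (Ω \ Ω')).toReal * M := by
    simp [Measure.real]
  rw [hconst, hvol] at hcmp
  have hpos : 0 < (volume Ω).toReal := volume_roof_box_pos hα hβ hδ
  refine le_of_mul_le_mul_left ?_ hpos
  linarith

theorem Quasiconvex.convexOn_smul_single {W : Matrix (Fin n) (Fin n) ℝ → ℝ}
    (hW : Quasiconvex W) (i : Fin n) :
    ConvexOn ℝ univ fun t : ℝ => W (t • Matrix.single i i (1 : ℝ)) := by
  refine LinearOrder.convexOn_of_lt convex_univ fun x _ y _ hxy a b ha hb hab => ?_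
  simp only [Matrix.smul_single, smul_eq_mul, mul_one]
  have hyx : 0 < y - x := sub_pos.2 hxy
  set F : Matrix (Fin n) (Fin n) ℝ := Matrix.single i i (a * x + b * y)
  set Wx := W (Matrix.single i i x)
  set Wy := W (Matrix.single i i y)
  -- These slopes carry `a x + b y` to `y` and to `x`. Below, `A` is the height of the chord at `a x
  -- + b y` and `B` its slope.
  have hα : 0 < a * (y - x) := mul_pos ha hyx
  have hβ : 0 < b * (y - x) := mul_pos hb hyx
  have hAα : W (F + Matrix.single i i (a * (y - x))) =
      (a * Wx + b * Wy) + (Wy - Wx) / (y - x) * (a * (y - x)) := by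
    have h1 : F + Matrix.single i i (a * (y - x)) = Matrix.single i i y := by
      rw [← Matrix.single_add]
      congr 1
      linear_combination y * hab
    rw [h1]
    field_simp
    linear_combination -Wy * hab
  have hAβ : W (F + Matrix.single i i (-(b * (y - x)))) =
      (a * Wx + b * Wy) + (Wy - Wx) / (y - x) * (-(b * (y - x))) := by
    have h1 : F + Matrix.single i i (-(b * (y - x))) = Matrix.single i i x := by
      rw [← Matrix.single_add]
      congr 1
      linear_combination x * hab
    rw [h1]
    field_simp
    linear_combination -Wx * hab
  set A := a * Wx + b * Wy
  set B := (Wy - Wx) / (y - x)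
  set α := a * (y - x)
  set β := b * (y - x)
  -- The slopes do not involve `δ`, so the sum of `D` is a bound uniform in `δ`, and letting `δ`
  -- tend to `0` removes the error.
  let D : Fin n × Bool → ℝ := fun q => |W (F + Matrix.single i q.1 (roofSlope i α β q)) -
      (A + B * if q.1 = i then roofSlope i α β q else 0)|
  have hM : ∀ q, D q ≤ ∑ q, D q := fun q =>
    Finset.single_le_sum (fun _ _ => abs_nonneg _) (Finset.mem_univ q)
  have hlim : Tendsto (fun δ : ℝ => (∑ q, D q) * (1 - ∏ k : Fin n, if k = i then 1 else (1 - δ)))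
      (𝓝[>] 0) (𝓝 0) := by
    have hcont : Continuous fun δ : ℝ =>
        (∑ q, D q) * (1 - ∏ k : Fin n, if k = i then 1 else (1 - δ)) := by
      refine continuous_const.mul (continuous_const.sub (continuous_finsetProd _ fun k _ => ?_))
      split_ifs <;> fun_prop
    have := hcont.tendsto 0
    simp only [sub_zero, ite_self, Finset.prod_const_one, sub_self, mul_zero] at this
    exact this.mono_left nhdsWithin_le_nhds
  have hfinal : W F - A ≤ 0 := by
    refine ge_of_tendsto hlim ?_
    filter_upwards [Ioo_mem_nhdsGT (zero_lt_one (α := ℝ))] with δ hδ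
    exact hW.sub_le_mul i F hα hβ hδ.1 hδ.2 hAα hAβ hM
  exact sub_nonpos.1 hfinal

end GenConvexity

end

theorem mainTheorem5 (n : ℕ) (hn : 1 ≤ n) (h : ℝ → ℝ)
    (W : Matrix (Fin n) (Fin n) ℝ → ℝ)
    (hW : ∀ F, W F = ∑ k : Fin n, h (GenConvexity.singularValue F k)) :
    (GenConvexity.RankOneConvex W ↔ (ConvexOn ℝ (Set.Ici 0) h ∧ MonotoneOn h (Set.Ici 0))) ∧
    (GenConvexity.Quasiconvex W ↔ (ConvexOn ℝ (Set.Ici 0) h ∧ MonotoneOn h (Set.Ici 0))) ∧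
    (GenConvexity.Polyconvex W ↔ (ConvexOn ℝ (Set.Ici 0) h ∧ MonotoneOn h (Set.Ici 0))) ∧
    (ConvexOn ℝ Set.univ W ↔ (ConvexOn ℝ (Set.Ici 0) h ∧ MonotoneOn h (Set.Ici 0))) := by
  have hconv : ConvexOn ℝ (Set.Ici 0) h ∧ MonotoneOn h (Set.Ici 0) → ConvexOn ℝ Set.univ W :=
    fun hh => funext hW ▸ GenConvexity.convexOn_sum_singularValue hh.1 hh.2
  let i : Fin n := ⟨0, hn⟩
  have hback : ConvexOn ℝ Set.univ (fun t : ℝ => W (t • Matrix.single i i (1 : ℝ))) →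
      ConvexOn ℝ (Set.Ici 0) h ∧ MonotoneOn h (Set.Ici 0) := by
    intro hc
    refine GenConvexity.convexOn_and_monotoneOn_of_convexOn_comp_abs ?_
    -- Adding a constant removes the contribution of the `n - 1` zero singular values.
    refine (hc.add (convexOn_const (-((n - 1) * h 0)) convex_univ)).congr fun t _ => ?_
    simp only [Pi.add_apply, hW, GenConvexity.sum_singularValue_smul_single]
    ring
  exact ⟨⟨fun H => hback (H.convexOn_smul_single i),
      fun hh => GenConvexity.rankOneConvex_of_convexOn (hconv hh)⟩,
    ⟨fun H => hback (H.convexOn_smul_single i),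
      fun hh => GenConvexity.quasiconvex_of_convexOn (hconv hh)⟩,
    ⟨fun H => hback (H.convexOn_smul_single i),
      fun hh => GenConvexity.polyconvex_of_convexOn hn (hconv hh)⟩,
    ⟨fun H => hback ((GenConvexity.rankOneConvex_of_convexOn H).convexOn_smul_single i), hconv⟩⟩
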